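/- Let $L,N$ be integers with $2\le N\le L$, let $0\le\phi<\frac{2\pi}{L}$ and $U>\frac{8}{L}$. Consider the Lieb–Wu equations with $N$ electrons and one down-spin, $$e^{\sqrt{-1}\,k_iL}=\frac{\lambda-\sin(k_i+\phi)-\sqrt{-1}\,U/4}{\lambda-\sin(k_i+\phi)+\sqrt{-1}\,U/4}\quad(1\le i\le N),\qquad \prod_{i=1}^{N}\frac{\lambda-\sin(k_i+\phi)-\sqrt{-1}\,U/4}{\lambda-\sin(k_i+\phi)+\sqrt{-1}\,U/4}=1 .$$ A $k$-$\Lambda$-2-string solution is a solution with $\lambda\in\mathbb{R}$ and a set of $N$ distinct wavenumbers of the form $k_1,\dots,k_{N-2}\in[0,2\pi)$, $k_{N-1}=\zeta-\sqrt{-1}\,\xi$, $k_N=\zeta+\sqrt{-1}\,\xi$ with $0\le\zeta<2\pi$ and $\xi>0$; solutions differing by a permutation of the wavenumbers are identified. It has label $(\{\ell_i\},m)$, where $\{\ell_1,\dots,\ell_{N-2}\}\subset\{\frac{2j-1}{2}\mid 1\le j\le L\}$ is a set of $N-2$ distinct branch indices and $m\in\mathbb{Z}$, if its real wavenumbers lie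 one in each of the branches $\frac{2\pi}{L}(\ell_i-\frac12)<k<\frac{2\pi}{L}(\ell_i+\frac12)$ and $\sum_{i=1}^{N-2}k_i+2\zeta=\frac{2\pi}{L}m$. Put $x=\frac{L}{2}-\frac{L\phi}{\pi}$. Call a label admissible if $$m\in\begin{cases}\big\{\sum_i(\ell_i+\tfrac12)+x+j \,\big|\, j=1,\dots,L-N+1\big\}, & x\in\mathbb{Z}\ (\text{the case of } so(4) \text{ symmetry}),\\ \big\{\sum_i(\ell_i+\tfrac12)+\lfloor x\rfloor+j \,\big|\, j=1,\dots,L-N+2\big\}, & x\notin\mathbb{Z}.\end{cases}$$ Then every admissible label is the label of at least one $k$-$\Lambda$-2-string solution, and no solution has two different labels. The number of admissible labels is $\binom{L}{N-2}(L-N+1)$ if $x\in\mathbb{Z}$ and $\binom{L}{N-2}(L-N+2)$ otherwise. In particular the Lieb–Wu equations with $M=1$ have at least $\binom{L}{N-2}(L-N+1)$ $k$-$\Lambda$-2-string solutions if $x\in\mathbb{Z}$, and at least $\binom{L}{N-2}(L-N+2)$ otherwise. -/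

import Mathlib

/-- The Lieb–Wu equations on an `L`-site ring with coupling `U` and flux parameter `φ`, for a set
`K` of wavenumbers and a set `Λ` of rapidities (`N = K.card`, `M = Λ.card`). The first two clauses
say that no denominator vanishes. -/
def LiebWuEquations (L : ℕ) (U φ : ℝ) (K Λ : Finset ℂ) : Prop :=
  (∀ k ∈ K, ∀ b ∈ Λ, b - Complex.sin (k + φ) + Complex.I * U / 4 ≠ 0) ∧
  (∀ a ∈ Λ, ∀ b ∈ Λ, b ≠ a → a - b + Complex.I * U / 2 ≠ 0) ∧
  (∀ k ∈ K, Complex.exp (Complex.I * k * L) =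
    ∏ b ∈ Λ, (b - Complex.sin (k + φ) - Complex.I * U / 4) /
      (b - Complex.sin (k + φ) + Complex.I * U / 4)) ∧
  (∀ a ∈ Λ, ∏ k ∈ K, (a - Complex.sin (k + φ) - Complex.I * U / 4) /
      (a - Complex.sin (k + φ) + Complex.I * U / 4) =
    ∏ b ∈ Λ.erase a, (a - b - Complex.I * U / 2) / (a - b + Complex.I * U / 2))

/-- The real variables of a configuration with one rapidity `lam`, a finite set `reals` of real
wavenumbers and one complex conjugate pair of wavenumbers `ζ ± i ξ`. -/
structure StringConfig where
  reals : Finset ℝ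
  ζ : ℝ
  ξ : ℝ
  lam : ℝ

open Classical in
/-- The set of all wavenumbers of the configuration. -/
noncomputable def StringConfig.wavenumbers (s : StringConfig) : Finset ℂ :=
  s.reals.image (fun x : ℝ => (x : ℂ)) ∪
    {(s.ζ : ℂ) - Complex.I * s.ξ, (s.ζ : ℂ) + Complex.I * s.ξ}

/-- The `k`-`Λ`-2-string solutions of the Lieb–Wu equations with `N` electrons and one down-spin.
Wavenumbers count modulo `2π`, so their real parts are normalized to `[0, 2π)`; they form a set,
so permuting them gives the same solution. With this normalization (and `0 < ξ`), distinct
configurations are distinct solutions. -/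
def kLambdaTwoStringSolutions (L N : ℕ) (U φ : ℝ) : Set StringConfig :=
  {s | s.reals.card + 2 = N ∧
    (∀ x ∈ s.reals, 0 ≤ x ∧ x < 2 * Real.pi) ∧
    0 ≤ s.ζ ∧ s.ζ < 2 * Real.pi ∧ 0 < s.ξ ∧
    LiebWuEquations L U φ s.wavenumbers {(s.lam : ℂ)}}

/-- The flux condition under which the system has `so(4)` symmetry. -/
def IsSO4Flux (L : ℕ) (φ : ℝ) : Prop :=
  ∃ z : ℤ, (L : ℝ) / 2 - L * φ / Real.pi = z

/-- The branch index `ℓ = (2j - 1)/2`, for `j = 1, …, L`. -/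
noncomputable def branchIndex (j : ℕ) : ℝ := (2 * (j : ℝ) - 1) / 2

/-- The branch of `q ↦ cot (q L / 2)` with index `ℓ = (2j - 1)/2`. -/
noncomputable def branch (L j : ℕ) : Set ℝ :=
  Set.Ioo (2 * Real.pi / L * (branchIndex j - 1 / 2)) (2 * Real.pi / L * (branchIndex j + 1 / 2))

/-- The labels `({ℓ_i}, m)`: a set of `N - 2` distinct branch indices `ℓ_i = (2 j_i - 1)/2`
(recorded through the set `J` of the `j_i ∈ {1, …, L}`), and an admissible integer `m`. -/
def stringLabels (L N : ℕ) (φ : ℝ) : Set (Finset ℕ × ℤ) :=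
  {p | p.1 ⊆ Finset.Icc 1 L ∧ p.1.card + 2 = N ∧
    ((IsSO4Flux L φ ∧ ∃ j : ℕ, 1 ≤ j ∧ j ≤ L - N + 1 ∧
        (p.2 : ℝ) = ∑ i ∈ p.1, (branchIndex i + 1 / 2)
          + ((L : ℝ) / 2 - L * φ / Real.pi) + j) ∨
     (¬ IsSO4Flux L φ ∧ ∃ j : ℕ, 1 ≤ j ∧ j ≤ L - N + 2 ∧
        (p.2 : ℝ) = ∑ i ∈ p.1, (branchIndex i + 1 / 2)
          + (⌊(L : ℝ) / 2 - L * φ / Real.pi⌋ : ℝ) + j))}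

/-- The configuration has label `({ℓ_i}, m)`: its real wavenumbers lie one in each of the branches
`ℓ_i`, and the sum of all its wavenumbers is `2π m / L`. -/
def StringConfig.HasLabel (L : ℕ) (s : StringConfig) (p : Finset ℕ × ℤ) : Prop :=
  (∀ x ∈ s.reals, ∃ j ∈ p.1, x ∈ branch L j) ∧
  (∀ j ∈ p.1, ∃! x, x ∈ s.reals ∧ x ∈ branch L j) ∧
  ∑ x ∈ s.reals, x + 2 * s.ζ = 2 * Real.pi / L * p.2

/-! Everything is reduced to one real parameter, the real part `ζ` of the string. Put `u = U/4`, so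
that `u > 2/L`. Splitting the equation for `ζ - iξ` into real and imaginary parts eliminates the
rapidity: the imaginary part constrains `ξ` alone, and the real part then gives the rapidity as
`stringRapidity` (`complexWavenumber_equation`). If `cos (ζ + φ) < 0`, the constraint has exactly
one root `ξ(ζ) > 0`, because `pairProfile` increases strictly from a limit at most `2/L` to
infinity. For a given rapidity, `realPhase_strictMono` yields one real wavenumber `κ_j` in each
branch.

Let `ζ` run over `(π/2 - φ, 3π/2 - φ)`. At the ends `ξ → ∞`, the rapidity tends to `+∞` and `-∞`,
and each `κ_j` tends to the upper and lower end of its branch. Hence the continuous function `∑ κ_j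
+ 2ζ` has limits `2π/L` times `∑ j + x` and `∑ j + x + L - N + 2`, and attains every value between
them (`exists_string_parameters`); monotonicity is not needed for existence. The product equation
only asks that the total momentum be `2πm/L` with `m` an integer, and the admissible `m` are the
integers strictly between those limits. Since a solution determines its label, distinct labels give
distinct solutions. -/

theorem Real.natCast_mul_sinh_le_sinh {y : ℝ} (hy : 0 ≤ y) (n : ℕ) :
    n * Real.sinh y ≤ Real.sinh (n * y) := by
  induction n with
  | zero => simp
  | succ n ih =>
    have h1 : 1 ≤ Real.cosh y := Real.one_le_cosh y
    have h2 : 1 ≤ Real.cosh (n * y) := Real.one_le_cosh _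
    have h3 : 0 ≤ Real.sinh y := Real.sinh_nonneg_iff.2 hy
    have h4 : 0 ≤ Real.sinh (n * y) := Real.sinh_nonneg_iff.2 (by positivity)
    push_cast
    rw [add_mul, one_mul, add_mul, one_mul, Real.sinh_add]
    nlinarith

/-- The imaginary part of the Lieb–Wu equation for the wavenumber `ζ - i y` reads
`-cos (ζ + φ) * pairProfile L (cos (L ζ)) y = U / 4`. -/
noncomputable def pairProfile (L : ℕ) (c y : ℝ) : ℝ :=
  Real.sinh y * (Real.cosh (L * y) - c) / Real.sinh (L * y)

/-! ### The imaginary-part equation as a function of the string width -/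

section pairProfile

variable {L : ℕ} {c y : ℝ}

theorem sinh_natCast_mul_pos (hL : 0 < L) (hy : 0 < y) : 0 < Real.sinh (L * y) :=
  Real.sinh_pos_iff.2 (by positivity)

/-- In the numerator of the derivative, `sinh (L y) * cosh y` exceeds `L * sinh y`. After this
replacement, `cosh² - sinh² = 1` leaves `L * sinh y * (cosh (L y) - 1) * (1 + c)`, which is
nonnegative. -/
theorem pairProfile_strictMonoOn (hL : 0 < L) (hc₁ : -1 ≤ c) (hc₂ : c ≤ 1) :
    StrictMonoOn (pairProfile L c) (Set.Ioi 0) := by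
  have hd : ∀ y ∈ Set.Ioi (0 : ℝ), HasDerivAt (pairProfile L c)
      (((Real.cosh y * (Real.cosh (L * y) - c) + Real.sinh y * (Real.sinh (L * y) * L)) *
        Real.sinh (L * y) - Real.sinh y * (Real.cosh (L * y) - c) * (Real.cosh (L * y) * L)) /
        Real.sinh (L * y) ^ 2) y := by
    intro y hy
    have h0 : HasDerivAt (fun y : ℝ => (L : ℝ) * y) L y := by
      simpa using (hasDerivAt_id y).const_mul (L : ℝ)
    exact ((Real.hasDerivAt_sinh y).mul (h0.cosh.sub_const c)).div h0.sinh
      (sinh_natCast_mul_pos hL hy).ne'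
  refine strictMonoOn_of_deriv_pos (convex_Ioi 0)
    (fun y hy => (hd y hy).continuousAt.continuousWithinAt) fun y hy => ?_
  rw [interior_Ioi] at hy
  rw [(hd y hy).deriv]
  have hS := sinh_natCast_mul_pos hL hy
  refine div_pos ?_ (by positivity)
  have hLy : (L : ℝ) * y ≠ 0 := by
    have : (0 : ℝ) < y := hy
    positivity
  have h1 : 1 < Real.cosh y := Real.one_lt_cosh.2 (ne_of_gt hy)
  have h2 : 1 < Real.cosh (L * y) := Real.one_lt_cosh.2 hLy
  have h3 : L * Real.sinh y ≤ Real.sinh (L * y) := Real.natCast_mul_sinh_le_sinh (le_of_lt hy) L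
  have h4 : 0 < Real.sinh y := Real.sinh_pos_iff.2 hy
  have h5 := Real.cosh_sq (L * y)
  have h6 : 0 < Real.cosh (L * y) - c := by linarith
  have h7 : L * Real.sinh y * (Real.cosh (L * y) - c)
      < Real.cosh y * Real.sinh (L * y) * (Real.cosh (L * y) - c) := by
    refine mul_lt_mul_of_pos_right ?_ h6
    nlinarith
  have h8 : 0 ≤ L * Real.sinh y * ((Real.cosh (L * y) - 1) * (1 + c)) :=
    mul_nonneg (by positivity) (mul_nonneg (by linarith) (by linarith))
  have h9 : (L : ℝ) * Real.sinh y * Real.cosh (L * y) ^ 2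
      = L * Real.sinh y * (Real.sinh (L * y) ^ 2 + 1) := by rw [h5]
  nlinarith

/-- The bound is uniform in `c` and tends to `2 / L` as `y → 0`; this is the source of the threshold
`U > 8 / L`. -/
theorem pairProfile_le (hL : 0 < L) (hc₁ : -1 ≤ c) (hy : 0 < y) :
    pairProfile L c y ≤ (Real.cosh (L * y) + 1) / L := by
  have hS := sinh_natCast_mul_pos hL hy
  have h2 : 1 ≤ Real.cosh (L * y) := Real.one_le_cosh _
  have h3 : L * Real.sinh y ≤ Real.sinh (L * y) := Real.natCast_mul_sinh_le_sinh hy.le L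
  have h4 : 0 < Real.sinh y := Real.sinh_pos_iff.2 hy
  have hL' : (0 : ℝ) < L := by exact_mod_cast hL
  rw [pairProfile, div_le_div_iff₀ hS hL']
  calc Real.sinh y * (Real.cosh (L * y) - c) * L
      ≤ Real.sinh y * (Real.cosh (L * y) + 1) * L := by gcongr; linarith
    _ = (Real.cosh (L * y) + 1) * (L * Real.sinh y) := by ring
    _ ≤ (Real.cosh (L * y) + 1) * Real.sinh (L * y) := by gcongr

theorem le_pairProfile (hL : 2 ≤ L) (hc₂ : c ≤ 1) (hy : 1 ≤ y) :
    y / 2 ≤ pairProfile L c y := by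
  have hy0 : 0 < y := by linarith
  have hS := sinh_natCast_mul_pos (by omega : 0 < L) hy0
  have hL' : (2 : ℝ) ≤ L := by exact_mod_cast hL
  have h1 : y ≤ Real.sinh y := Real.self_le_sinh_iff.2 hy0.le
  -- With `E = exp (L y)`, the inequality `h3` amounts to `(E - 1) * (E - 3) ≥ 0`.
  have h2 : 2 + 1 ≤ Real.exp (L * y) :=
    le_trans (by nlinarith) (Real.add_one_le_exp ((L : ℝ) * y))
  have h3 : Real.sinh (L * y) / 2 ≤ Real.cosh (L * y) - 1 := by
    rw [Real.sinh_eq, Real.cosh_eq, Real.exp_neg]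
    have := inv_pos.2 (Real.exp_pos (L * y))
    have h5 : Real.exp (L * y) * (Real.exp (L * y))⁻¹ = 1 :=
      mul_inv_cancel₀ (Real.exp_pos _).ne'
    nlinarith
  rw [pairProfile, le_div_iff₀ hS]
  calc y / 2 * Real.sinh (L * y) = y * (Real.sinh (L * y) / 2) := by ring
    _ ≤ Real.sinh y * (Real.cosh (L * y) - c) := by
      apply mul_le_mul h1 (by linarith) (by positivity) (by linarith)

theorem exists_pairProfile_eq (hL : 2 ≤ L) (hc₁ : -1 ≤ c) (hc₂ : c ≤ 1) {a : ℝ}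
    (ha : 2 / L < a) : ∃ y, 0 < y ∧ pairProfile L c y = a := by
  have hL0 : 0 < L := by omega
  have hL' : (0 : ℝ) < L := by exact_mod_cast hL0
  obtain ⟨y₀, hy₀, hlt⟩ : ∃ y₀, 0 < y₀ ∧ pairProfile L c y₀ < a := by
    have ht : Filter.Tendsto (fun y : ℝ => (Real.cosh (L * y) + 1) / L) (nhdsWithin 0 (Set.Ioi 0))
        (nhds (2 / L)) := by
      have : Continuous (fun y : ℝ => (Real.cosh (L * y) + 1) / L) := by fun_prop
      have h := this.tendsto 0
      norm_num at h
      exact h.mono_left nhdsWithin_le_nhds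
    obtain ⟨y, hy, hy0⟩ := ((ht.eventually_lt_const ha).and self_mem_nhdsWithin).exists
    exact ⟨y, hy0, (pairProfile_le hL0 hc₁ hy0).trans_lt hy⟩
  have hgt : a ≤ pairProfile L c (max 1 (2 * a)) := by
    have := le_pairProfile hL hc₂ (le_max_left 1 (2 * a))
    have := le_max_right 1 (2 * a)
    linarith
  have hy₁ : 0 < max 1 (2 * a) := lt_of_lt_of_le one_pos (le_max_left _ _)
  have hcont : ContinuousOn (pairProfile L c) (Set.Ioi 0) := by
    unfold pairProfile
    refine ContinuousOn.div (by fun_prop) (by fun_prop) fun y hy => ?_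
    exact (sinh_natCast_mul_pos hL0 hy).ne'
  obtain ⟨y, hy, h⟩ := isPreconnected_Ioi.intermediate_value hy₀ hy₁ hcont ⟨hlt.le, hgt⟩
  exact ⟨y, hy, h⟩

end pairProfile

/-! ### Width and rapidity of the string as functions of `ζ` -/

section stringParameters

variable {L : ℕ} {u φ : ℝ}

/-- For a given real part `ζ` of the string, a choice of the imaginary part. -/
theorem exists_stringWidth (hL : 2 ≤ L) (hu : 2 / (L : ℝ) < u) (φ : ℝ) :
    ∃ ξ : ℝ → ℝ, ∀ ζ, Real.cos (ζ + φ) < 0 →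
      0 < ξ ζ ∧ -Real.cos (ζ + φ) * pairProfile L (Real.cos (L * ζ)) (ξ ζ) = u := by
  have : ∀ ζ, ∃ y, Real.cos (ζ + φ) < 0 →
      0 < y ∧ -Real.cos (ζ + φ) * pairProfile L (Real.cos (L * ζ)) y = u := by
    intro ζ
    by_cases hζ : Real.cos (ζ + φ) < 0
    · have h0 : 0 < -Real.cos (ζ + φ) := by linarith
      have h1 : -Real.cos (ζ + φ) ≤ 1 := by linarith [Real.neg_one_le_cos (ζ + φ)]
      have hu0 : 0 < u := lt_of_le_of_lt (by positivity) hu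
      have hua : 2 / (L : ℝ) < u / -Real.cos (ζ + φ) :=
        hu.trans_le ((le_div_iff₀ h0).2 (by nlinarith))
      obtain ⟨y, hy, h⟩ := exists_pairProfile_eq hL (Real.neg_one_le_cos (L * ζ))
        (Real.cos_le_one _) hua
      exact ⟨y, fun _ => ⟨hy, by rw [h, mul_div_cancel₀ _ h0.ne']⟩⟩
    -- Junk value where the cosine is not negative.
    · exact ⟨0, fun h => absurd h hζ⟩
  choose ξ hξ using this
  exact ⟨ξ, hξ⟩

variable {ξ : ℝ → ℝ}

/-- An implicit function argument without derivatives: a strict inequality between the profile at a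
fixed height `a` and `u` persists for nearby `ζ`, and monotonicity in the width turns it into an
inequality between `ξ ζ` and `a`. -/
theorem stringWidth_continuousAt (hL : 0 < L)
    (hξ : ∀ ζ, Real.cos (ζ + φ) < 0 →
      0 < ξ ζ ∧ -Real.cos (ζ + φ) * pairProfile L (Real.cos (L * ζ)) (ξ ζ) = u)
    {ζ₀ : ℝ} (hζ₀ : Real.cos (ζ₀ + φ) < 0) : ContinuousAt ξ ζ₀ := by
  have hev : ∀ᶠ ζ in nhds ζ₀, Real.cos (ζ + φ) < 0 :=
    (by fun_prop : Continuous fun ζ => Real.cos (ζ + φ)).continuousAt.eventually_lt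
      continuousAt_const hζ₀
  have hmono := fun ζ => pairProfile_strictMonoOn hL (Real.neg_one_le_cos (L * ζ))
    (Real.cos_le_one (L * ζ))
  have hcont : ∀ a, Continuous fun ζ =>
      -Real.cos (ζ + φ) * pairProfile L (Real.cos (L * ζ)) a := by
    intro a
    unfold pairProfile
    fun_prop
  obtain ⟨hpos₀, heq₀⟩ := hξ ζ₀ hζ₀
  refine tendsto_order.2 ⟨fun a ha => ?_, fun a ha => ?_⟩
  · rcases le_or_gt a 0 with h | h
    · filter_upwards [hev] with ζ hζ using h.trans_lt (hξ ζ hζ).1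
    · have hlt : -Real.cos (ζ₀ + φ) * pairProfile L (Real.cos (L * ζ₀)) a < u := by
        rw [← heq₀]
        exact mul_lt_mul_of_pos_left (hmono ζ₀ h hpos₀ ha) (by linarith)
      filter_upwards [hev, (hcont a).continuousAt.eventually_lt continuousAt_const hlt]
        with ζ hζ h'
      obtain ⟨hpos, heq⟩ := hξ ζ hζ
      rw [← heq] at h'
      exact ((hmono ζ).lt_iff_lt h hpos).1 (lt_of_mul_lt_mul_left h' (by linarith))
  · have h : 0 < a := hpos₀.trans ha
    have hlt : u < -Real.cos (ζ₀ + φ) * pairProfile L (Real.cos (L * ζ₀)) a := by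
      nth_rw 1 [← heq₀]
      exact mul_lt_mul_of_pos_left (hmono ζ₀ hpos₀ h ha) (by linarith)
    filter_upwards [hev, continuousAt_const.eventually_lt (hcont a).continuousAt hlt]
      with ζ hζ h'
    obtain ⟨hpos, heq⟩ := hξ ζ hζ
    nth_rw 1 [← heq] at h'
    exact ((hmono ζ).lt_iff_lt hpos h).1 (lt_of_mul_lt_mul_left h' (by linarith))

/-- At any fixed height the left side of the constraint is at most a constant times `-cos (ζ + φ)`,
hence eventually below `u`, so the root lies above that height. -/
theorem stringWidth_tendsto_atTop (hL : 0 < L) (hu : 0 < u)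
    (hξ : ∀ ζ, Real.cos (ζ + φ) < 0 →
      0 < ξ ζ ∧ -Real.cos (ζ + φ) * pairProfile L (Real.cos (L * ζ)) (ξ ζ) = u)
    {l : Filter ℝ} (hl : ∀ᶠ ζ in l, Real.cos (ζ + φ) < 0)
    (hl₀ : Filter.Tendsto (fun ζ => Real.cos (ζ + φ)) l (nhds 0)) :
    Filter.Tendsto ξ l Filter.atTop := by
  refine Filter.tendsto_atTop.2 fun b => ?_
  set a := max b 1
  have ha : 0 < a := lt_of_lt_of_le one_pos (le_max_right _ _)
  have hlim : Filter.Tendsto (fun ζ => -Real.cos (ζ + φ) * ((Real.cosh (L * a) + 1) / L)) l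
      (nhds 0) := by simpa using hl₀.neg.mul_const ((Real.cosh (L * a) + 1) / L)
  filter_upwards [hl, hlim.eventually_lt_const hu] with ζ hζ h
  obtain ⟨hpos, heq⟩ := hξ ζ hζ
  refine (le_max_left b 1).trans (le_of_lt ?_)
  refine ((pairProfile_strictMonoOn hL (Real.neg_one_le_cos (L * ζ))
    (Real.cos_le_one (L * ζ))).lt_iff_lt ha hpos).1 ?_
  have h' := pairProfile_le hL (Real.neg_one_le_cos (L * ζ)) ha
  refine lt_of_mul_lt_mul_left (?_ : -Real.cos (ζ + φ) * _ < -Real.cos (ζ + φ) * _) (by linarith)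
  rw [heq]
  exact (mul_le_mul_of_nonneg_left h' (by linarith)).trans_lt h

/-- The rapidity of a string with wavenumbers `ζ ± i ξ`. -/
noncomputable def stringRapidity (L : ℕ) (φ ζ ξ : ℝ) : ℝ :=
  Real.sin (ζ + φ) * Real.cosh ξ +
    Real.cos (ζ + φ) * (Real.sin (L * ζ) * (Real.sinh ξ / Real.sinh (L * ξ)))

/-- For large width the rapidity is thus governed by `sin (ζ + φ) * cosh y`, whose sign at the ends
of the interval decides the infinite limit. -/
theorem abs_stringRapidity_sub_le (hL : 0 < L) {ζ y : ℝ} (hy : 0 < y) :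
    |stringRapidity L φ ζ y - Real.sin (ζ + φ) * Real.cosh y| ≤ 1 := by
  have hS := sinh_natCast_mul_pos hL hy
  have h4 : 0 < Real.sinh y := Real.sinh_pos_iff.2 hy
  have h1 : (1 : ℝ) ≤ L := by exact_mod_cast hL
  have h3 : Real.sinh y / Real.sinh (L * y) ≤ 1 := by
    rw [div_le_one hS]
    have := Real.natCast_mul_sinh_le_sinh hy.le L
    nlinarith
  rw [stringRapidity, add_sub_cancel_left, abs_mul, abs_mul, abs_of_pos (div_pos h4 hS)]
  have h5 := mul_le_one₀ (Real.abs_sin_le_one (L * ζ)) (div_pos h4 hS).le h3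
  exact mul_le_one₀ (Real.abs_cos_le_one (ζ + φ))
    (mul_nonneg (abs_nonneg _) (div_pos h4 hS).le) h5

theorem Real.tendsto_cosh_atTop : Filter.Tendsto Real.cosh Filter.atTop Filter.atTop :=
  Filter.tendsto_atTop_mono' _ (by
    filter_upwards [Filter.eventually_ge_atTop 0] with x hx
    exact (Real.self_le_sinh_iff.2 hx).trans (Real.sinh_lt_cosh x).le) Filter.tendsto_id

theorem stringRapidity_tendsto_atTop (hL : 0 < L) {l : Filter ℝ}
    (hξ : Filter.Tendsto ξ l Filter.atTop)
    (hl : Filter.Tendsto (fun ζ => Real.sin (ζ + φ)) l (nhds 1)) :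
    Filter.Tendsto (fun ζ => stringRapidity L φ ζ (ξ ζ)) l Filter.atTop := by
  have h1 : Filter.Tendsto (fun ζ => Real.sin (ζ + φ) * Real.cosh (ξ ζ)) l Filter.atTop :=
    hl.pos_mul_atTop one_pos (Real.tendsto_cosh_atTop.comp hξ)
  refine Filter.tendsto_atTop_mono' l ?_ (Filter.tendsto_atTop_add_const_right l (-1) h1)
  filter_upwards [hξ.eventually_gt_atTop 0] with ζ hζ
  linarith [(abs_le.1 (abs_stringRapidity_sub_le (φ := φ) (ζ := ζ) hL hζ)).1]

theorem stringRapidity_tendsto_atBot (hL : 0 < L) {l : Filter ℝ}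
    (hξ : Filter.Tendsto ξ l Filter.atTop)
    (hl : Filter.Tendsto (fun ζ => Real.sin (ζ + φ)) l (nhds (-1))) :
    Filter.Tendsto (fun ζ => stringRapidity L φ ζ (ξ ζ)) l Filter.atBot := by
  have h1 : Filter.Tendsto (fun ζ => Real.sin (ζ + φ) * Real.cosh (ξ ζ)) l Filter.atBot :=
    hl.neg_mul_atTop (by norm_num) (Real.tendsto_cosh_atTop.comp hξ)
  refine Filter.tendsto_atBot_mono' l ?_ (Filter.tendsto_atBot_add_const_right l 1 h1)
  filter_upwards [hξ.eventually_gt_atTop 0] with ζ hζ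
  linarith [(abs_le.1 (abs_stringRapidity_sub_le (φ := φ) (ζ := ζ) hL hζ)).2]

theorem stringRapidity_continuousAt (hL : 0 < L) {ζ₀ : ℝ} (hpos : 0 < ξ ζ₀)
    (hξ : ContinuousAt ξ ζ₀) :
    ContinuousAt (fun ζ => stringRapidity L φ ζ (ξ ζ)) ζ₀ := by
  unfold stringRapidity
  have h1 : ContinuousAt (fun ζ => Real.sinh (ξ ζ)) ζ₀ := Real.continuous_sinh.continuousAt.comp hξ
  have h2 : ContinuousAt (fun ζ => Real.cosh (ξ ζ)) ζ₀ := Real.continuous_cosh.continuousAt.comp hξ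
  have h3 : ContinuousAt (fun ζ => Real.sinh (L * ξ ζ)) ζ₀ :=
    Real.continuous_sinh.continuousAt.comp (continuousAt_const.mul hξ)
  have h4 : ContinuousAt (fun ζ => Real.sinh (ξ ζ) / Real.sinh (L * ξ ζ)) ζ₀ :=
    h1.div h3 (sinh_natCast_mul_pos hL hpos).ne'
  have h5 : ContinuousAt (fun ζ => Real.sin (ζ + φ)) ζ₀ := by fun_prop
  have h6 : ContinuousAt (fun ζ => Real.cos (ζ + φ)) ζ₀ := by fun_prop
  have h7 : ContinuousAt (fun ζ => Real.sin (L * ζ)) ζ₀ := by fun_prop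
  exact (h5.mul h2).add (h6.mul (h7.mul h4))

end stringParameters

/-! ### Real wavenumbers at a given rapidity -/

section realWavenumbers

variable {L : ℕ} {u φ lam : ℝ}

theorem Real.abs_arctan_sub_arctan_le (a b : ℝ) :
    |Real.arctan a - Real.arctan b| ≤ |a - b| := by
  have h := Convex.norm_image_sub_le_of_norm_deriv_le (f := Real.arctan) (C := 1) (s := Set.univ)
    (x := b) (y := a) (fun x _ => Real.differentiableAt_arctan x) (fun x _ => by
      rw [Real.deriv_arctan, Real.norm_eq_abs, abs_of_pos (by positivity), div_le_one (by positivity)]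
      nlinarith [sq_nonneg x]) convex_univ trivial trivial
  simpa using h

/-- The phase whose values `π (j - 1/2)` are attained at the real wavenumbers. -/
noncomputable def realPhase (L : ℕ) (u φ lam k : ℝ) : ℝ :=
  k * L / 2 + Real.arctan ((Real.sin (k + φ) - lam) / u)

/-- Since `sin` and `arctan` are 1-Lipschitz, the arctangent term has slope at most `1 / u` in size,
less than the slope `L / 2` of the linear term. -/
theorem realPhase_strictMono (hL : 0 < L) (hu : 2 / (L : ℝ) < u) :
    StrictMono (realPhase L u φ lam) := by
  intro a b hab
  have hu0 : 0 < u := lt_of_le_of_lt (by positivity) hu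
  have hL' : (0 : ℝ) < L := by exact_mod_cast hL
  have h1 := (abs_le.1 (Real.abs_arctan_sub_arctan_le ((Real.sin (b + φ) - lam) / u)
    ((Real.sin (a + φ) - lam) / u))).1
  have h2 : |(Real.sin (b + φ) - lam) / u - (Real.sin (a + φ) - lam) / u| ≤ (b - a) / u := by
    rw [← sub_div, sub_sub_sub_cancel_right, abs_div, abs_of_pos hu0]
    have h := Real.abs_sin_sub_sin_le (b + φ) (a + φ)
    rw [add_sub_add_right_eq_sub, abs_of_pos (sub_pos.2 hab)] at h
    gcongr
  have h3 : (b - a) / u < (b - a) * L / 2 := by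
    rw [div_lt_iff₀ hL'] at hu
    rw [div_lt_div_iff₀ hu0 two_pos]
    nlinarith [sub_pos.2 hab]
  unfold realPhase
  nlinarith

/-- At the two ends of branch `j` the linear term is `π (j - 1)` and `π j`, while the arctangent
stays strictly within `π / 2`. -/
theorem exists_realPhase_eq (hL : 0 < L) (u φ lam : ℝ) (j : ℕ) :
    ∃ k, realPhase L u φ lam k = Real.pi * (j - 1 / 2) := by
  have hL' : (0 : ℝ) < L := by exact_mod_cast hL
  have hcont : Continuous (realPhase L u φ lam) := by
    unfold realPhase
    exact (by fun_prop : Continuous fun k : ℝ => k * L / 2).add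
      (Real.continuous_arctan.comp (by fun_prop))
  have h := intermediate_value_univ (2 * Real.pi / L * (j - 1)) (2 * Real.pi / L * j) hcont
  refine h ⟨?_, ?_⟩
  · have h1 := Real.arctan_lt_pi_div_two
      ((Real.sin (2 * Real.pi / L * (j - 1) + φ) - lam) / u)
    have h2 : 2 * Real.pi / L * ((j : ℝ) - 1) * L / 2 = Real.pi * (j - 1) := by field_simp
    rw [realPhase, h2]
    linarith
  · have h1 := Real.neg_pi_div_two_lt_arctan ((Real.sin (2 * Real.pi / L * j + φ) - lam) / u)
    have h2 : 2 * Real.pi / L * (j : ℝ) * L / 2 = Real.pi * j := by field_simp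
    rw [realPhase, h2]
    linarith

theorem mem_branch_of_realPhase_eq (hL : 0 < L) {j : ℕ} {k : ℝ}
    (hk : realPhase L u φ lam k = Real.pi * (j - 1 / 2)) : k ∈ branch L j := by
  have hL' : (0 : ℝ) < L := by exact_mod_cast hL
  have h1 := Real.arctan_lt_pi_div_two ((Real.sin (k + φ) - lam) / u)
  have h2 := Real.neg_pi_div_two_lt_arctan ((Real.sin (k + φ) - lam) / u)
  rw [realPhase] at hk
  unfold branch branchIndex
  constructor
  · rw [div_mul_eq_mul_div, div_lt_iff₀ hL']
    linarith
  · rw [div_mul_eq_mul_div, lt_div_iff₀ hL']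
    linarith

variable {κ : ℝ → ℝ} {j : ℕ}

theorem realWavenumber_continuous (hL : 0 < L) (hu : 2 / (L : ℝ) < u)
    (hκ : ∀ lam, realPhase L u φ lam (κ lam) = Real.pi * (j - 1 / 2)) : Continuous κ := by
  have hcont : ∀ k, Continuous fun lam => realPhase L u φ lam k := by
    intro k
    unfold realPhase
    exact continuous_const.add (Real.continuous_arctan.comp (by fun_prop))
  refine continuous_iff_continuousAt.2 fun x => tendsto_order.2 ⟨fun a ha => ?_, fun a ha => ?_⟩
  · have h := realPhase_strictMono (φ := φ) (lam := x) hL hu ha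
    rw [hκ] at h
    filter_upwards [(hcont a).continuousAt.eventually_lt continuousAt_const h] with y hy
    rw [← hκ y] at hy
    exact (realPhase_strictMono hL hu).lt_iff_lt.1 hy
  · have h := realPhase_strictMono (φ := φ) (lam := x) hL hu ha
    rw [hκ] at h
    filter_upwards [continuousAt_const.eventually_lt (hcont a).continuousAt h] with y hy
    rw [← hκ y] at hy
    exact (realPhase_strictMono hL hu).lt_iff_lt.1 hy

/-- The sine is bounded, so the arctangent tends to `-π / 2` wherever `κ` goes, which forces the
linear term to `π j`. -/
theorem realWavenumber_tendsto_atTop (hL : 0 < L) (hu : 0 < u)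
    (hκ : ∀ lam, realPhase L u φ lam (κ lam) = Real.pi * (j - 1 / 2)) :
    Filter.Tendsto κ Filter.atTop (nhds (2 * Real.pi / L * j)) := by
  have hL' : (0 : ℝ) < L := by exact_mod_cast hL
  have h1 : Filter.Tendsto (fun x => (Real.sin (κ x + φ) - x) / u) Filter.atTop Filter.atBot := by
    refine Filter.Tendsto.atBot_div_const hu ?_
    refine Filter.tendsto_atBot_mono (fun x => ?_)
      (Filter.tendsto_atBot_add_const_left Filter.atTop (1 : ℝ) Filter.tendsto_neg_atTop_atBot)
    linarith [Real.sin_le_one (κ x + φ)]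
  have h2 := (Real.tendsto_arctan_atBot.mono_right nhdsWithin_le_nhds).comp h1
  have h3 := (h2.const_sub (Real.pi * (j - 1 / 2))).mul_const (2 / (L : ℝ))
  convert h3 using 2 with x
  · rw [← hκ x, realPhase]
    simp only [Function.comp]
    field_simp
    ring
  · field_simp
    ring

theorem realWavenumber_tendsto_atBot (hL : 0 < L) (hu : 0 < u)
    (hκ : ∀ lam, realPhase L u φ lam (κ lam) = Real.pi * (j - 1 / 2)) :
    Filter.Tendsto κ Filter.atBot (nhds (2 * Real.pi / L * (j - 1))) := by
  have hL' : (0 : ℝ) < L := by exact_mod_cast hL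
  have h1 : Filter.Tendsto (fun x => (Real.sin (κ x + φ) - x) / u) Filter.atBot Filter.atTop := by
    refine Filter.Tendsto.atTop_div_const hu ?_
    refine Filter.tendsto_atTop_mono (fun x => ?_)
      (Filter.tendsto_atTop_add_const_left Filter.atBot (-1 : ℝ) Filter.tendsto_neg_atBot_atTop)
    linarith [Real.neg_one_le_sin (κ x + φ)]
  have h2 := (Real.tendsto_arctan_atTop.mono_right nhdsWithin_le_nhds).comp h1
  have h3 := (h2.const_sub (Real.pi * (j - 1 / 2))).mul_const (2 / (L : ℝ))
  convert h3 using 2 with x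
  · rw [← hκ x, realPhase]
    simp only [Function.comp]
    field_simp
    ring
  · field_simp
    ring

end realWavenumbers

/-! ### The intermediate value argument -/

theorem exists_string_parameters {L : ℕ} {u : ℝ} (φ : ℝ) (hL : 2 ≤ L) (hu : 2 / (L : ℝ) < u)
    {κ : ℕ → ℝ → ℝ}
    (hκ : ∀ j lam, realPhase L u φ lam (κ j lam) = Real.pi * (j - 1 / 2)) (J : Finset ℕ) {T : ℝ}
    (hT₁ : ∑ j ∈ J, 2 * Real.pi / L * (j : ℝ) + 2 * (Real.pi / 2 - φ) < T)
    (hT₂ : T < ∑ j ∈ J, 2 * Real.pi / L * ((j : ℝ) - 1) + 2 * (3 * Real.pi / 2 - φ)) :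
    ∃ ζ ξ : ℝ, ζ < 3 * Real.pi / 2 - φ ∧ 0 < ξ ∧
      -Real.cos (ζ + φ) * pairProfile L (Real.cos (L * ζ)) ξ = u ∧
      ∑ j ∈ J, κ j (stringRapidity L φ ζ ξ) + 2 * ζ = T := by
  have hL0 : 0 < L := by omega
  have hu0 : 0 < u := lt_of_le_of_lt (by positivity) hu
  obtain ⟨ξ, hξ⟩ := exists_stringWidth hL hu φ
  set a := Real.pi / 2 - φ with ha
  set b := 3 * Real.pi / 2 - φ with hb
  have hab : a < b := by linarith [Real.pi_pos]
  have hcos : ∀ ζ ∈ Set.Ioo a b, Real.cos (ζ + φ) < 0 := fun ζ hζ =>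
    Real.cos_neg_of_pi_div_two_lt_of_lt (by linarith [hζ.1]) (by linarith [hζ.2])
  have hca : Real.cos (a + φ) = 0 := by rw [ha, sub_add_cancel, Real.cos_pi_div_two]
  have hsa : Real.sin (a + φ) = 1 := by rw [ha, sub_add_cancel, Real.sin_pi_div_two]
  have h32 : 3 * Real.pi / 2 = Real.pi / 2 + Real.pi := by ring
  have hcb : Real.cos (b + φ) = 0 := by
    rw [hb, sub_add_cancel, h32, Real.cos_add_pi, Real.cos_pi_div_two, neg_zero]
  have hsb : Real.sin (b + φ) = -1 := by
    rw [hb, sub_add_cancel, h32, Real.sin_add_pi, Real.sin_pi_div_two]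
  have htc : ∀ x, Filter.Tendsto (fun ζ => Real.cos (ζ + φ)) (nhds x) (nhds (Real.cos (x + φ))) :=
    fun x => (by fun_prop : Continuous fun ζ => Real.cos (ζ + φ)).tendsto x
  have hts : ∀ x, Filter.Tendsto (fun ζ => Real.sin (ζ + φ)) (nhds x) (nhds (Real.sin (x + φ))) :=
    fun x => (by fun_prop : Continuous fun ζ => Real.sin (ζ + φ)).tendsto x
  have hIa : Set.Ioo a b ∈ nhdsWithin a (Set.Ioi a) := Ioo_mem_nhdsGT hab
  have hIb : Set.Ioo a b ∈ nhdsWithin b (Set.Iio b) := Ioo_mem_nhdsLT hab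
  set h : ℝ → ℝ := fun ζ => ∑ j ∈ J, κ j (stringRapidity L φ ζ (ξ ζ)) + 2 * ζ with hh
  have hcont : ContinuousOn h (Set.Ioo a b) := by
    intro ζ hζ
    refine ContinuousAt.continuousWithinAt ?_
    have hG := stringRapidity_continuousAt (φ := φ) hL0 (hξ ζ (hcos ζ hζ)).1
      (stringWidth_continuousAt hL0 hξ (hcos ζ hζ))
    exact (tendsto_finsetSum J fun j _ =>
      (realWavenumber_continuous hL0 hu (hκ j)).continuousAt.comp hG).add
      (continuousAt_const.mul continuousAt_id)
  have hlima : Filter.Tendsto h (nhdsWithin a (Set.Ioi a))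
      (nhds (∑ j ∈ J, 2 * Real.pi / L * (j : ℝ) + 2 * a)) := by
    have hξa := stringWidth_tendsto_atTop hL0 hu0 hξ
      (Filter.mem_of_superset hIa hcos)
      ((hca ▸ htc a).mono_left nhdsWithin_le_nhds)
    have hG := stringRapidity_tendsto_atTop hL0 hξa ((hsa ▸ hts a).mono_left nhdsWithin_le_nhds)
    exact (tendsto_finsetSum J fun j _ =>
      (realWavenumber_tendsto_atTop hL0 hu0 (hκ j)).comp hG).add
      ((continuousAt_const.mul continuousAt_id).tendsto.mono_left nhdsWithin_le_nhds)
  have hlimb : Filter.Tendsto h (nhdsWithin b (Set.Iio b))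
      (nhds (∑ j ∈ J, 2 * Real.pi / L * ((j : ℝ) - 1) + 2 * b)) := by
    have hξb := stringWidth_tendsto_atTop hL0 hu0 hξ
      (Filter.mem_of_superset hIb hcos)
      ((hcb ▸ htc b).mono_left nhdsWithin_le_nhds)
    have hG := stringRapidity_tendsto_atBot hL0 hξb ((hsb ▸ hts b).mono_left nhdsWithin_le_nhds)
    exact (tendsto_finsetSum J fun j _ =>
      (realWavenumber_tendsto_atBot hL0 hu0 (hκ j)).comp hG).add
      ((continuousAt_const.mul continuousAt_id).tendsto.mono_left nhdsWithin_le_nhds)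
  obtain ⟨ζ, hζ, hT⟩ := isPreconnected_Ioo.intermediate_value_Ioo
    (Filter.le_principal_iff.2 hIa) (Filter.le_principal_iff.2 hIb) hcont hlima hlimb ⟨hT₁, hT₂⟩
  obtain ⟨h1, h2⟩ := hξ ζ (hcos ζ hζ)
  exact ⟨ζ, ξ ζ, hζ.2, h1, h2, hT⟩

/-! ### From real parameters back to the complex equations -/

section equations

open Complex

/-- Inverts the Cayley transform; the nonvanishing denominator comes for free because `(t + c) * (1
- w) = 2 * c`. -/
theorem div_eq_of_mul_one_sub_eq {t c w : ℂ} (hc : c ≠ 0)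
    (h : t * (1 - w) = c * (1 + w)) : t + c ≠ 0 ∧ w = (t - c) / (t + c) := by
  have h1 : (t + c) * (1 - w) = 2 * c := by linear_combination h
  have h2 : t + c ≠ 0 := by
    rintro h3
    rw [h3, zero_mul] at h1
    exact hc (by simpa using h1.symm)
  refine ⟨h2, ?_⟩
  rw [eq_div_iff h2]
  linear_combination -h

/-- The Lieb–Wu equation holds for the real wavenumbers picked out by `realPhase`. -/
theorem realWavenumber_equation {L : ℕ} {u φ lam k : ℝ} {j : ℕ} (hu : 0 < u)
    (hk : realPhase L u φ lam k = Real.pi * (j - 1 / 2)) :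
    (lam : ℂ) - sin (k + φ) + I * u ≠ 0 ∧
    exp (I * k * L) = (lam - sin (k + φ) - I * u) / (lam - sin (k + φ) + I * u) := by
  set θ := Real.arctan ((Real.sin (k + φ) - lam) / u) with hθ
  have hc : Real.cos θ ≠ 0 := (Real.cos_arctan_pos _).ne'
  have htan : Real.sin θ * u = Real.cos θ * (Real.sin (k + φ) - lam) := by
    have h := Real.tan_arctan ((Real.sin (k + φ) - lam) / u)
    rw [← hθ, Real.tan_eq_sin_div_cos, div_eq_div_iff hc hu.ne'] at h
    linarith
  have htan' : sin (θ : ℂ) * u = cos (θ : ℂ) * (sin (k + φ) - lam) := by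
    exact_mod_cast congrArg (fun x : ℝ => (x : ℂ)) htan
  have hexp : exp (I * k * L) = -(exp (-(θ * I))) ^ 2 := by
    have h1 : (k : ℂ) * L = 2 * Real.pi * j - Real.pi - 2 * θ := by
      have : k * L = 2 * Real.pi * j - Real.pi - 2 * θ := by
        rw [realPhase] at hk
        linarith
      exact_mod_cast congrArg (fun x : ℝ => (x : ℂ)) this
    have h2 : I * k * L = -(θ * I) + -(θ * I) - Real.pi * I + j * (2 * Real.pi * I) := by
      linear_combination I * h1
    rw [h2, exp_add, exp_nat_mul_two_pi_mul_I, mul_one, exp_sub, exp_pi_mul_I, exp_add]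
    ring
  have hne : (lam : ℂ) - sin (k + φ) + I * u ≠ 0 := by
    intro h
    have h' : ((lam - Real.sin (k + φ) : ℝ) : ℂ) + (u : ℝ) * I = 0 := by
      push_cast
      linear_combination h
    have := congrArg Complex.im h'
    simp only [add_im, ofReal_im, mul_im, ofReal_re, I_im, I_re, zero_im] at this
    linarith
  refine ⟨hne, ?_⟩
  rw [eq_div_iff hne, hexp]
  have hc' : cos (θ : ℂ) ≠ 0 := by exact_mod_cast hc
  have he : exp (-(θ * I)) = cos (θ : ℂ) - sin (θ : ℂ) * I := by
    rw [← neg_mul, exp_mul_I, cos_neg, sin_neg]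
    ring
  have hcs := sin_sq_add_cos_sq (θ : ℂ)
  -- After multiplying by `cos θ`, the relation `htan'` replaces `lam - sin (k + φ)` by `-u tan θ`
  -- without division.
  apply mul_left_cancel₀ hc'
  rw [he]
  set S := sin (θ : ℂ)
  set C := cos (θ : ℂ)
  linear_combination (-((C - S * I) ^ 2 + 1)) * htan' - u * I * (C - S * I) * hcs +
    (u * I * (C - S * I) * S ^ 2 + u * S * ((C - S * I) ^ 2 + 1)) * I_sq

/-- The Lieb–Wu equation holds for the complex wavenumbers of a string; it is used with both signs
of `ξ`. -/
theorem complexWavenumber_equation {L : ℕ} {u φ ζ ξ : ℝ} (hL : 0 < L) (hu : 0 < u) (hξ : ξ ≠ 0)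
    (h : -Real.cos (ζ + φ) * pairProfile L (Real.cos (L * ζ)) ξ = u) :
    (stringRapidity L φ ζ ξ : ℂ) - sin ((ζ - I * ξ) + φ) + I * u ≠ 0 ∧
    exp (I * (ζ - I * ξ) * L) =
      (stringRapidity L φ ζ ξ - sin ((ζ - I * ξ) + φ) - I * u) /
      (stringRapidity L φ ζ ξ - sin ((ζ - I * ξ) + φ) + I * u) := by
  have hLξ : (L : ℝ) * ξ ≠ 0 := by positivity
  have hS : Real.sinh (L * ξ) ≠ 0 := by rwa [Ne, Real.sinh_eq_zero]
  have hC : 1 < Real.cosh (L * ξ) := Real.one_lt_cosh.2 hLξ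
  have hC' : Real.cosh (L * ξ) - Real.cos (L * ζ) ≠ 0 :=
    ne_of_gt (by linarith [Real.cos_le_one (L * ζ)])
  have hre : (stringRapidity L φ ζ ξ - Real.sin (ζ + φ) * Real.cosh ξ) *
      (Real.cosh (L * ξ) - Real.cos (L * ζ)) = -u * Real.sin (L * ζ) := by
    rw [← h, stringRapidity, pairProfile]
    field_simp
    ring
  have him : Real.cos (ζ + φ) * Real.sinh ξ * (Real.cosh (L * ξ) - Real.cos (L * ζ)) =
      -u * Real.sinh (L * ξ) := by
    rw [← h, pairProfile]
    field_simp
  have hsin : sin ((ζ - I * ξ) + φ) =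
      Real.sin (ζ + φ) * Real.cosh ξ - Real.cos (ζ + φ) * Real.sinh ξ * I := by
    push_cast
    rw [show (ζ : ℂ) - I * ξ + φ = (ζ + φ) - ξ * I by ring, sin_sub, sin_mul_I, cos_mul_I]
    ring
  have hexp : exp (I * (ζ - I * ξ) * L) = (Real.cosh (L * ξ) + Real.sinh (L * ξ)) *
      (Real.cos (L * ζ) + Real.sin (L * ζ) * I) := by
    push_cast
    rw [cosh_add_sinh, ← exp_mul_I, ← exp_add]
    congr 1
    linear_combination -(ξ * L : ℂ) * I_sq
  have hu' : I * (u : ℂ) ≠ 0 := mul_ne_zero I_ne_zero (by exact_mod_cast hu.ne')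
  have hcs : (Real.sin (L * ζ) : ℂ) ^ 2 + (Real.cos (L * ζ) : ℂ) ^ 2 = 1 := by
    exact_mod_cast Real.sin_sq_add_cos_sq (L * ζ)
  have hch : (Real.cosh (L * ξ) : ℂ) ^ 2 - (Real.sinh (L * ξ) : ℂ) ^ 2 = 1 := by
    exact_mod_cast Real.cosh_sq_sub_sinh_sq (L * ξ)
  replace hre := congrArg (fun x : ℝ => (x : ℂ)) hre
  replace him := congrArg (fun x : ℝ => (x : ℂ)) him
  have hC'' : (Real.cosh (L * ξ) : ℂ) - Real.cos (L * ζ) ≠ 0 := by exact_mod_cast hC'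
  simp only [ofReal_mul, ofReal_sub, ofReal_neg] at hre him
  -- For `w = exp (Lξ + iLζ)`, `(1 + w) / (1 - w)` is `(-sinh (Lξ) + i sin (Lζ)) / (cosh (Lξ) - cos
  -- (Lζ))`; `hre` and `him` are the two parts of this identity.
  refine div_eq_of_mul_one_sub_eq hu' (mul_left_cancel₀ hC'' ?_)
  rw [hsin, hexp]
  generalize (Real.cosh (L * ξ) : ℂ) = ch at *
  generalize (Real.sinh (L * ξ) : ℂ) = sh at *
  generalize (Real.sin (L * ζ) : ℂ) = S at *
  generalize (Real.cos (L * ζ) : ℂ) = C at *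
  linear_combination (1 - (ch + sh) * (C + S * I)) * (hre + I * him) +
    u * (I * (ch + sh) * hcs - I * (C + S * I) * hch + ((ch + sh) * S * C - S) * I_sq)

end equations

/-! ### Disjoint branches and uniqueness of labels -/

section branches

variable {L : ℕ}

theorem mem_branch_iff (hL : 0 < L) {j : ℕ} {x : ℝ} :
    x ∈ branch L j ↔ (j : ℝ) - 1 < x * L / (2 * Real.pi) ∧ x * L / (2 * Real.pi) < j := by
  have hL' : (0 : ℝ) < L := by exact_mod_cast hL
  have hpi := Real.pi_pos
  unfold branch branchIndex
  rw [Set.mem_Ioo, lt_div_iff₀ (by positivity), div_lt_iff₀ (by positivity),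
    div_mul_eq_mul_div, div_mul_eq_mul_div, div_lt_iff₀ hL', lt_div_iff₀ hL']
  constructor <;> rintro ⟨h1, h2⟩ <;> constructor <;> linarith

theorem branch_index_unique (hL : 0 < L) {i j : ℕ} {x : ℝ} (hi : x ∈ branch L i)
    (hj : x ∈ branch L j) : i = j := by
  rw [mem_branch_iff hL] at hi hj
  have h1 : (i : ℝ) < j + 1 := by linarith [hi.1, hj.2]
  have h2 : (j : ℝ) < i + 1 := by linarith [hj.1, hi.2]
  norm_cast at h1 h2
  omega

theorem StringConfig.HasLabel.unique (hL : 0 < L) {s : StringConfig} {p q : Finset ℕ × ℤ}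
    (hp : s.HasLabel L p) (hq : s.HasLabel L q) : p = q := by
  have key : ∀ p q : Finset ℕ × ℤ, s.HasLabel L p → s.HasLabel L q → p.1 ⊆ q.1 := by
    intro p q hp hq j hj
    obtain ⟨x, ⟨hx, hxj⟩, -⟩ := hp.2.1 j hj
    obtain ⟨i, hi, hxi⟩ := hq.1 x hx
    rwa [branch_index_unique hL hxj hxi]
  refine Prod.ext ((key p q hp hq).antisymm (key q p hq hp)) ?_
  have hL' : (0 : ℝ) < L := by exact_mod_cast hL
  have h := hp.2.2.symm.trans hq.2.2
  exact_mod_cast mul_left_cancel₀ (by positivity) h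

end branches

/-! ### Counting labels and bounding `m` -/

section labels

variable {L N : ℕ} {φ : ℝ}

theorem branchIndex_add_half (i : ℕ) : branchIndex i + 1 / 2 = i := by
  unfold branchIndex
  ring

/-- The labels, for a given integer offset `z` and `n` values of `m` per set of branches. -/
theorem encard_labels (k n : ℕ) (z : ℤ) :
    {p : Finset ℕ × ℤ | p.1 ⊆ Finset.Icc 1 L ∧ p.1.card = k ∧
      ∃ j : ℕ, 1 ≤ j ∧ j ≤ n ∧ p.2 = ∑ i ∈ p.1, (i : ℤ) + z + j}.encard =
      ((L.choose k * n : ℕ) : ℕ∞) := by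
  have h : {p : Finset ℕ × ℤ | p.1 ⊆ Finset.Icc 1 L ∧ p.1.card = k ∧
      ∃ j : ℕ, 1 ≤ j ∧ j ≤ n ∧ p.2 = ∑ i ∈ p.1, (i : ℤ) + z + j} =
      (fun p : Finset ℕ × ℕ => (p.1, ∑ i ∈ p.1, (i : ℤ) + z + (p.2 : ℤ))) ''
        ((Finset.powersetCard k (Finset.Icc 1 L) ×ˢ Finset.Icc 1 n : Finset _) :
          Set (Finset ℕ × ℕ)) := by
    ext ⟨J, m⟩
    simp only [Set.mem_ofPred_eq, Set.mem_image, Finset.mem_coe, Finset.mem_product,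
      Finset.mem_powersetCard, Finset.mem_Icc, Prod.exists, Prod.mk.injEq]
    constructor
    · rintro ⟨h1, h2, j, h3, h4, h5⟩
      exact ⟨J, j, ⟨⟨h1, h2⟩, h3, h4⟩, rfl, h5.symm⟩
    · rintro ⟨J', j, ⟨⟨h1, h2⟩, h3, h4⟩, rfl, h5⟩
      exact ⟨h1, h2, j, h3, h4, h5.symm⟩
  rw [h, Set.InjOn.encard_image, Set.encard_coe_eq_coe_finsetCard]
  · simp
  · rintro ⟨J, i⟩ - ⟨J', j⟩ - hij
    simp only [Prod.mk.injEq] at hij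
    obtain ⟨rfl, h2⟩ := hij
    simp only [Prod.mk.injEq, true_and]
    omega

theorem encard_stringLabels_of_isSO4Flux (hN : 2 ≤ N) (h : IsSO4Flux L φ) :
    (stringLabels L N φ).encard = ((L.choose (N - 2) * (L - N + 1) : ℕ) : ℕ∞) := by
  obtain ⟨z, hz⟩ := id h
  rw [← encard_labels (L := L) (N - 2) (L - N + 1) z]
  congr 1
  ext ⟨J, m⟩
  simp only [stringLabels, branchIndex_add_half, h, hz, Set.mem_ofPred_eq, true_and,
    not_true_eq_false, false_and, or_false]
  refine and_congr_right fun _ => and_congr (by omega) (exists_congr fun j =>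
    and_congr_right fun _ => and_congr_right fun _ => ?_)
  rw [← @Int.cast_inj ℝ]
  push_cast
  rfl

theorem encard_stringLabels_of_not_isSO4Flux (hN : 2 ≤ N) (h : ¬ IsSO4Flux L φ) :
    (stringLabels L N φ).encard = ((L.choose (N - 2) * (L - N + 2) : ℕ) : ℕ∞) := by
  rw [← encard_labels (L := L) (N - 2) (L - N + 2) ⌊(L : ℝ) / 2 - L * φ / Real.pi⌋]
  congr 1
  ext ⟨J, m⟩
  simp only [stringLabels, branchIndex_add_half, h, Set.mem_ofPred_eq, true_and,
    not_false_eq_true, false_and, false_or]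
  refine and_congr_right fun _ => and_congr (by omega) (exists_congr fun j =>
    and_congr_right fun _ => and_congr_right fun _ => ?_)
  rw [← @Int.cast_inj ℝ]
  push_cast
  rfl

/-- The bounds on `m` shared by both kinds of labels. -/
theorem bounds_of_mem_stringLabels (hNL : N ≤ L) {p : Finset ℕ × ℤ}
    (hp : p ∈ stringLabels L N φ) :
    (p.2 : ℝ) - ∑ i ∈ p.1, (i : ℝ) - ((L : ℝ) / 2 - L * φ / Real.pi) ∈
        Set.Ioo 0 ((L : ℝ) - N + 2) ∧
      ∑ i ∈ p.1, (i : ℝ) + (⌊(L : ℝ) / 2 - L * φ / Real.pi⌋ + 1 : ℤ) ≤ p.2 := by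
  obtain ⟨-, -, h⟩ := hp
  simp only [branchIndex_add_half] at h
  set x := (L : ℝ) / 2 - L * φ / Real.pi with hx
  push_cast
  rcases h with ⟨-, j, hj1, hj2, h⟩ | ⟨hS, j, hj1, hj2, h⟩
  · have h1 : (1 : ℝ) ≤ j := by exact_mod_cast hj1
    have h2 : (j : ℝ) ≤ L - N + 1 := by
      rw [← Nat.cast_sub hNL]
      exact_mod_cast hj2
    refine ⟨⟨by linarith, by linarith⟩, by linarith [Int.floor_le x]⟩
  · have h1 : (1 : ℝ) ≤ j := by exact_mod_cast hj1
    have h2 : (j : ℝ) ≤ L - N + 2 := by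
      rw [← Nat.cast_sub hNL]
      exact_mod_cast hj2
    -- Strictness for non-integral `x` is what admits the extra value `j = L - N + 2`.
    have h3 : (⌊x⌋ : ℝ) < x := lt_of_le_of_ne (Int.floor_le x) fun h => hS ⟨_, h.symm⟩
    refine ⟨⟨by linarith [Int.lt_floor_add_one x], by linarith⟩, by linarith⟩

end labels

/-! ### Assembling the solutions -/

section solutions

open Complex

theorem StringConfig.sum_wavenumbers {s : StringConfig} (hξ : 0 < s.ξ) :
    ∑ k ∈ s.wavenumbers, k = ((∑ x ∈ s.reals, x + 2 * s.ζ : ℝ) : ℂ) := by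
  classical
  have him : ((s.ζ : ℂ) + I * s.ξ).im ≠ 0 ∧ ((s.ζ : ℂ) - I * s.ξ).im ≠ 0 := by
    simp [hξ.ne']
  have hne : (s.ζ : ℂ) - I * s.ξ ≠ (s.ζ : ℂ) + I * s.ξ := by
    intro h
    have := congrArg Complex.im h
    simp at this
    linarith
  have hdisj : Disjoint (s.reals.image (fun x : ℝ => (x : ℂ)))
      {(s.ζ : ℂ) - I * s.ξ, (s.ζ : ℂ) + I * s.ξ} := by
    rw [Finset.disjoint_left]
    intro k hk hk'
    obtain ⟨x, -, rfl⟩ := Finset.mem_image.1 hk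
    rcases Finset.mem_insert.1 hk' with h | h
    · exact him.2 (by rw [← h]; exact ofReal_im x)
    · exact him.1 (by rw [← Finset.mem_singleton.1 h]; exact ofReal_im x)
  have hw : s.wavenumbers = s.reals.image (fun x : ℝ => (x : ℂ)) ∪
      {(s.ζ : ℂ) - I * s.ξ, (s.ζ : ℂ) + I * s.ξ} := by
    unfold StringConfig.wavenumbers
    congr
  rw [hw, Finset.sum_union hdisj, Finset.sum_pair hne,
    Finset.sum_image fun _ _ _ _ h => ofReal_injective h]
  push_cast
  ring

theorem StringConfig.forall_wavenumbers {s : StringConfig} {P : ℂ → Prop}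
    (h₁ : ∀ x ∈ s.reals, P (x : ℂ)) (h₂ : P (s.ζ - I * s.ξ)) (h₃ : P (s.ζ + I * s.ξ)) :
    ∀ k ∈ s.wavenumbers, P k := by
  intro k hk
  simp only [StringConfig.wavenumbers, Finset.mem_union, Finset.mem_image, Finset.mem_insert,
    Finset.mem_singleton] at hk
  rcases hk with ⟨x, hx, rfl⟩ | rfl | rfl
  exacts [h₁ x hx, h₂, h₃]

/-- With one rapidity, the second Lieb–Wu equation is the quantization of the total momentum. -/
theorem liebWuEquations_singleton {L : ℕ} {U φ lam : ℝ} {K : Finset ℂ} {m : ℤ} (hL : 0 < L)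
    (h : ∀ k ∈ K, (lam : ℂ) - sin (k + φ) + I * U / 4 ≠ 0 ∧
      exp (I * k * L) = (lam - sin (k + φ) - I * U / 4) / (lam - sin (k + φ) + I * U / 4))
    (hsum : ∑ k ∈ K, k = ((2 * Real.pi / L * m : ℝ) : ℂ)) :
    LiebWuEquations L U φ K {(lam : ℂ)} := by
  refine ⟨fun k hk b hb => ?_, fun a ha b hb hab => ?_, fun k hk => ?_, fun a ha => ?_⟩
  · rw [Finset.mem_singleton.1 hb]
    exact (h k hk).1
  · rw [Finset.mem_singleton] at ha hb
    exact absurd (hb.trans ha.symm) hab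
  · rw [Finset.prod_singleton]
    exact (h k hk).2
  · rw [Finset.mem_singleton.1 ha, Finset.erase_singleton, Finset.prod_empty,
      ← Finset.prod_congr rfl fun k hk => (h k hk).2, ← exp_sum, ← Finset.sum_mul,
      ← Finset.mul_sum, hsum, exp_eq_one_iff]
    refine ⟨m, ?_⟩
    have hL' : (L : ℂ) ≠ 0 := by exact_mod_cast hL.ne'
    push_cast
    field_simp

theorem exists_solution_of_mem_stringLabels {L N : ℕ} (hN : 2 ≤ N) (hNL : N ≤ L) {U φ : ℝ}
    (hU : 8 / (L : ℝ) < U) (hφ₁ : φ < 2 * Real.pi / L) (hφ₀ : 0 ≤ φ)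
    {p : Finset ℕ × ℤ} (hp : p ∈ stringLabels L N φ) :
    ∃ s ∈ kLambdaTwoStringSolutions L N U φ, s.HasLabel L p := by
  have hL : 2 ≤ L := hN.trans hNL
  have hL0 : 0 < L := by omega
  have hL' : (0 : ℝ) < L := by exact_mod_cast hL0
  have hL2 : (2 : ℝ) ≤ L := by exact_mod_cast hL
  have hpi := Real.pi_pos
  have hu : 2 / (L : ℝ) < U / 4 := by
    rw [div_lt_iff₀ hL'] at hU ⊢
    linarith
  have hu0 : 0 < U / 4 := lt_of_le_of_lt (by positivity) hu
  obtain ⟨⟨hm₁, hm₂⟩, hm₃⟩ := bounds_of_mem_stringLabels hNL hp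
  obtain ⟨hJ, hcard, -⟩ := hp
  obtain ⟨J, m⟩ := p
  dsimp only at *
  choose κ hκ using fun (j : ℕ) (lam : ℝ) => exists_realPhase_eq hL0 (U / 4) φ lam j
  have hbr : ∀ j lam, κ j lam ∈ branch L j := fun j lam => mem_branch_of_realPhase_eq hL0 (hκ j lam)
  have hc : (J.card : ℝ) + 2 = N := by exact_mod_cast hcard
  -- As `2 (π/2 - φ) = (2π/L) x`, both required bounds are `0 < m - ∑ j - x < L - N + 2` scaled by
  -- `2π/L`.
  obtain ⟨ζ, ξ, hζ₁, hξ, hpair, hsum⟩ := exists_string_parameters φ hL hu hκ J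
    (T := 2 * Real.pi / L * m)
    (by
      rw [← Finset.mul_sum]
      have : 2 * Real.pi / L * ((m : ℝ) - ∑ i ∈ J, (i : ℝ) - ((L : ℝ) / 2 - L * φ / Real.pi)) =
        2 * Real.pi / L * m - 2 * Real.pi / L * ∑ i ∈ J, (i : ℝ) - 2 * (Real.pi / 2 - φ) := by
        field_simp
      have h := mul_pos (by positivity : 0 < 2 * Real.pi / L) hm₁
      linarith)
    (by
      rw [← Finset.mul_sum, Finset.sum_sub_distrib, Finset.sum_const, nsmul_eq_mul, mul_one]
      have : 2 * Real.pi / L * ((m : ℝ) - ∑ i ∈ J, (i : ℝ) - ((L : ℝ) / 2 - L * φ / Real.pi)) =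
        2 * Real.pi / L * m - 2 * Real.pi / L * ∑ i ∈ J, (i : ℝ) - 2 * (Real.pi / 2 - φ) := by
        field_simp
      have h := mul_lt_mul_of_pos_left hm₂ (by positivity : 0 < 2 * Real.pi / L)
      have h' : 2 * Real.pi / L * ((L : ℝ) - N + 2) =
        2 * Real.pi - 2 * Real.pi / L * J.card := by
        rw [← hc]
        field_simp
        ring
      linarith)
  set lam := stringRapidity L φ ζ ξ with hlam
  have hinj : Set.InjOn (fun j => κ j lam) J := fun i _ j _ hij =>
    branch_index_unique hL0 (hbr i lam) ((show κ i lam = κ j lam from hij) ▸ hbr j lam)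
  have hlt : ∀ j, κ j lam < 2 * Real.pi / L * j := by
    intro j
    have := (hbr j lam).2
    rwa [show branchIndex j + 1 / 2 = (j : ℝ) from branchIndex_add_half j] at this
  -- Here `L ≥ 2` and `φ < 2π/L` give `x > -1`, so `m ≥ ∑ j`, while the `κ_j` sum to at most `(2π/L)
  -- ∑ j`.
  have hζ₀ : 0 ≤ ζ := by
    have h1 : ∑ j ∈ J, κ j lam ≤ 2 * Real.pi / L * ∑ j ∈ J, (j : ℝ) := by
      rw [Finset.mul_sum]
      exact Finset.sum_le_sum fun j _ => (hlt j).le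
    have h2 : (0 : ℝ) ≤ (⌊(L : ℝ) / 2 - L * φ / Real.pi⌋ + 1 : ℤ) := by
      have h3 : (-1 : ℤ) ≤ ⌊(L : ℝ) / 2 - L * φ / Real.pi⌋ := by
        rw [Int.le_floor]
        have : L * φ / Real.pi < 2 := by
          rw [lt_div_iff₀ hL'] at hφ₁
          rw [div_lt_iff₀ hpi]
          linarith
        push_cast
        linarith
      exact_mod_cast (by omega : (0 : ℤ) ≤ ⌊(L : ℝ) / 2 - L * φ / Real.pi⌋ + 1)
    have h4 := mul_le_mul_of_nonneg_left (show ∑ i ∈ J, (i : ℝ) ≤ m by linarith)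
      (by positivity : 0 ≤ 2 * Real.pi / L)
    linarith
  let s : StringConfig := ⟨J.image fun j => κ j lam, ζ, ξ, lam⟩
  have hreals : ∑ x ∈ s.reals, x + 2 * s.ζ = 2 * Real.pi / L * m := by
    rw [← hsum]
    exact congrArg (· + 2 * ζ) (Finset.sum_image hinj)
  refine ⟨s, ⟨?_, ?_, hζ₀, by dsimp only [s]; linarith, hξ, ?_⟩, ?_, ?_, hreals⟩
  · rw [← hcard, Finset.card_image_of_injOn hinj]
  · intro x hx
    obtain ⟨j, hj, rfl⟩ := Finset.mem_image.1 hx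
    have hjL := Finset.mem_Icc.1 (hJ hj)
    have h1 : (1 : ℝ) ≤ j := by exact_mod_cast hjL.1
    have h2 : (j : ℝ) ≤ L := by exact_mod_cast hjL.2
    obtain ⟨h3, h4⟩ := (mem_branch_iff hL0).1 (hbr j lam)
    rw [lt_div_iff₀ (by positivity)] at h3
    rw [div_lt_iff₀ (by positivity)] at h4
    constructor
    · by_contra! h
      nlinarith
    · by_contra! h
      nlinarith
  · refine liebWuEquations_singleton hL0 ?_ ((StringConfig.sum_wavenumbers hξ).trans
      (congrArg _ hreals))
    have hI : I * (U : ℂ) / 4 = I * ((U / 4 : ℝ) : ℂ) := by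
      push_cast
      ring
    rw [hI]
    refine StringConfig.forall_wavenumbers (fun x hx => ?_) ?_ ?_
    · obtain ⟨j, hj, rfl⟩ := Finset.mem_image.1 hx
      exact realWavenumber_equation hu0 (hκ j lam)
    · exact complexWavenumber_equation hL0 hu0 hξ.ne' hpair
    -- Rapidity and profile are even in `ξ`, so the conjugate wavenumber satisfies the same
    -- constraint with the same rapidity.
    · have hlam' : stringRapidity L φ ζ (-ξ) = lam := by
        simp [hlam, stringRapidity, neg_div_neg_eq]
      have hprof : ∀ c, pairProfile L c (-ξ) = pairProfile L c ξ := by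
        intro c
        simp [pairProfile, neg_div_neg_eq]
      have h := complexWavenumber_equation (φ := φ) (ζ := ζ) hL0 hu0 (neg_ne_zero.2 hξ.ne')
        (by rw [hprof, hpair])
      rw [hlam'] at h
      simpa only [ofReal_neg, mul_neg, sub_neg_eq_add] using h
  · intro x hx
    obtain ⟨j, hj, rfl⟩ := Finset.mem_image.1 hx
    exact ⟨j, hj, hbr j lam⟩
  · intro j hj
    refine ⟨κ j lam, ⟨Finset.mem_image_of_mem _ hj, hbr j lam⟩, ?_⟩
    rintro y ⟨hy, hyj⟩
    obtain ⟨i, hi, rfl⟩ := Finset.mem_image.1 hy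
    rw [branch_index_unique hL0 (hbr i lam) hyj]

end solutions

theorem proposition2 (L N : ℕ) (hN : 2 ≤ N) (hNL : N ≤ L) (U φ : ℝ)
    (hU : 8 / (L : ℝ) < U) (hφ₀ : 0 ≤ φ) (hφ₁ : φ < 2 * Real.pi / L) :
    -- every label is realized by a solution, and a solution has at most one label
    (∀ p ∈ stringLabels L N φ, ∃ s ∈ kLambdaTwoStringSolutions L N U φ, s.HasLabel L p) ∧
    (∀ s ∈ kLambdaTwoStringSolutions L N U φ, ∀ p q : Finset ℕ × ℤ,
      s.HasLabel L p → s.HasLabel L q → p = q) ∧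
    -- the number of labels, and hence of solutions found
    (IsSO4Flux L φ →
      (stringLabels L N φ).encard = ((L.choose (N - 2) * (L - N + 1) : ℕ) : ℕ∞) ∧
      ((L.choose (N - 2) * (L - N + 1) : ℕ) : ℕ∞) ≤
        (kLambdaTwoStringSolutions L N U φ).encard) ∧
    (¬ IsSO4Flux L φ →
      (stringLabels L N φ).encard = ((L.choose (N - 2) * (L - N + 2) : ℕ) : ℕ∞) ∧
      ((L.choose (N - 2) * (L - N + 2) : ℕ) : ℕ∞) ≤
        (kLambdaTwoStringSolutions L N U φ).encard) := by
  have hL : 0 < L := by omega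
  have hex : ∀ p ∈ stringLabels L N φ, ∃ s ∈ kLambdaTwoStringSolutions L N U φ, s.HasLabel L p :=
    fun p hp => exists_solution_of_mem_stringLabels hN hNL hU hφ₁ hφ₀ hp
  have hle : (stringLabels L N φ).encard ≤ (kLambdaTwoStringSolutions L N U φ).encard := by
    have : Nonempty StringConfig := ⟨⟨∅, 0, 0, 0⟩⟩
    choose! f hf hlabel using hex
    exact Set.encard_le_encard_of_injOn hf fun p hp q hq hpq =>
      (hlabel p hp).unique hL (by rw [hpq]; exact hlabel q hq)
  refine ⟨hex, fun s _ p q hp hq => hp.unique hL hq, fun h => ?_, fun h => ?_⟩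
  · rw [← encard_stringLabels_of_isSO4Flux hN h]
    exact ⟨rfl, hle⟩
  · rw [← encard_stringLabels_of_not_isSO4Flux hN h]
    exact ⟨rfl, hle⟩
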